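/- Let $q$ be a prime power. For subspaces $U,V$ of $\mathbb{F}_q^n$ let $d_S(U,V)=\dim(U+V)-\dim(U\cap V)$. An $(n,d,\{k\})_q$ constant dimension code (CDC) is a nonempty set of $k$-dimensional subspaces of $\mathbb{F}_q^n$ such that any two distinct members are at distance $d_S$ at least $d$; $A_q(n,d,\{k\})$ is the maximum size of such a code. Let $\left[\begin{smallmatrix}n\\k\end{smallmatrix}\right]_q=\prod_{i=0}^{k-1}\frac{q^n-q^i}{q^k-q^i}$, and for an integer $S$ put $$N_q(x,y,z;S)=\left\lfloor\frac{\left[\begin{smallmatrix}x\\z-y+1\end{smallmatrix}\right]_q-S\left[\begin{smallmatrix}z\\y-1\end{smallmatrix}\right]_q}{\sum_{i=0}^{y-1}q^{i^2}\left[\begin{smallmatrix}z-y+1\\i\end{smallmatrix}\right]_q\left[\begin{smallmatrix}x-(z-y+1)\\i\end{smallmatrix}\right]_q}\right\rfloor .$$ Let $\delta\ge2$ and $h\ge\delta-1$ be integers. For $0\le i\le 2$ and $0\le j\le\min\{1,\lfloor\frac{h+1}{\delta}\rfloor-1\}$ let $d_1^{(i,j)}=\lceil\delta/2\rceil$ if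 $j-i\ge\frac{h+2}{\delta}-4$, $d_1^{(i,j)}=\lfloor\delta/2\rfloor$ otherwise, and $d_2^{(i,j)}=\delta-d_1^{(i,j)}$. Let $S$ be the size of some $(4\delta,2\delta,\{2\delta\})_q$ CDC (for instance the best-known one). If $N_q(4\delta,\delta,2\delta;S)>0$, then $$\begin{aligned}A_q(6\delta+h,2\delta,\{2\delta\})\ \ge\ & S\cdot q^{(2\delta+h)(\delta+1)}+N_q(4\delta,\delta,2\delta;S)\cdot q^{\max\{\delta+h+1,2\delta\}(\min\{\delta+h+1,2\delta\}-\delta+1)}\\&+\left(1+\left[\begin{smallmatrix}2\delta\\\delta\end{smallmatrix}\right]_q(q^{4\delta+h}-1)\right)\\&+\sum_{i=0}^{2}\ \sum_{j=0}^{\min\{1,\lfloor\frac{h+1}{\delta}\rfloor-1\}}q^{\min\{((4-i)\delta-1)d_2^{(i,j)},\,(h+1-j\delta)d_1^{(i,j)}\}}\cdot q^{(4-i)\delta+h-j\delta}.\end{aligned}$$ In particular, if $N_q(4\delta,\delta,2\delta;A_q(4\delta,2\delta,\{2\delta\}))>0$, this inequality holds with $S=A_q(4\delta,2\delta,\{2\delta\})$.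 -/

import Mathlib

namespace SubspaceCode

/-- The subspace distance `dim (U + V) - dim (U ∩ V)` (the truncated subtraction is harmless, as
`U ⊓ V ≤ U ⊔ V`). -/
noncomputable def subspaceDist {F : Type*} [Field F] {n : ℕ} (U V : Submodule F (Fin n → F)) : ℕ :=
  Module.finrank F (U ⊔ V : Submodule F (Fin n → F)) -
    Module.finrank F (U ⊓ V : Submodule F (Fin n → F))

/-- `C` is an `(n, d, {k})_q` constant dimension code, `F` being the field with `q` elements:
a nonempty set of `k`-dimensional subspaces of `F ^ n`, any two distinct ones of which are at
subspace distance at least `d`. -/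
structure IsCDC {F : Type*} [Field F] (n d k : ℕ) (C : Finset (Submodule F (Fin n → F))) :
    Prop where
  nonempty : C.Nonempty
  dim_eq : ∀ U ∈ C, Module.finrank F U = k
  dist_ge : ∀ U ∈ C, ∀ V ∈ C, U ≠ V → d ≤ subspaceDist U V

/-- `A_q(n, d, {k})`: the maximum size of an `(n, d, {k})_q` constant dimension code. For `F` finite
and `k ≤ n` the set of sizes is finite and nonempty, so that the supremum is a maximum. -/
noncomputable def maxCDCSize (F : Type*) [Field F] (n d k : ℕ) : ℕ :=
  sSup {M : ℕ | ∃ C : Finset (Submodule F (Fin n → F)), IsCDC n d k C ∧ C.card = M}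

/-- The `q`-ary Gaussian binomial coefficient `[n choose k]_q`. -/
def gaussBinom (q n k : ℕ) : ℚ :=
  ∏ i ∈ Finset.range k, ((q : ℚ) ^ n - (q : ℚ) ^ i) / ((q : ℚ) ^ k - (q : ℚ) ^ i)

/-- The number `N_q(x, y, z)`, where `S` is the size of the `(x, 2y, {z})_q` constant dimension code
that it refers to. -/
def numN (q x y z S : ℕ) : ℤ :=
  ⌊(gaussBinom q x (z - y + 1) - (S : ℚ) * gaussBinom q z (y - 1)) /
    (∑ i ∈ Finset.range y,
      (q : ℚ) ^ (i ^ 2) * gaussBinom q (z - y + 1) i * gaussBinom q (x - (z - y + 1)) i)⌋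

/-- `d₁^{(i,j)}`. -/
def dOne (δ h i j : ℕ) : ℕ :=
  if ((h : ℚ) + 2) / (δ : ℚ) - 4 ≤ (j : ℚ) - (i : ℚ) then ⌈(δ : ℚ) / 2⌉₊ else ⌊(δ : ℚ) / 2⌋₊

/-- `d₂^{(i,j)} = δ - d₁^{(i,j)}`. -/
def dTwo (δ h i j : ℕ) : ℕ := δ - dOne δ h i j

end SubspaceCode

/-! ### Linearized polynomials and Gabidulin codes -/

namespace SubspaceCode

open Module Polynomial

/-! Two `2δ`-dimensional spaces are at distance at least `2δ` exactly when they meet in dimension at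
most `δ`. The four summands of the bound count four families in `(X₁ × X₂) × (X₃ × X₄)`, the factors
having dimensions `4δ`, `δ - 1`, `h + 1 - δ`, `2δ`. (1) Graphs over the members of the given code in
`X₁`, with values in the other factors. (2) Graphs over `W × X₂` with values in `X₃ × X₄`, where `W`
runs through `(δ + 1)`-dimensional subspaces of `X₁` contained in no codeword and pairwise meeting
in dimension at most 1; a greedy choice yields at least `numN` of them (`exists_avoiding_code`). (3)
Graphs over `X₄` of maps of rank at most `δ`; `card_rank_le` counts these. (4) Products `P × Q` with
`P ≤ X₁ × X₂` and `Q ≤ X₃ × X₄` of dimension `δ`, from the coset construction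
(`exists_coset_family`). In (1)-(3) the maps come from Gabidulin codes, so graphs over the same base
meet in dimension at most `δ` (`exists_lifted_family`). Different families are compared through a
projection injective on one of the two spaces, since the intersection then embeds in the
intersection of the images (`isSeparated_union`). In `X₁`, (1) and (2) project to `U` and `W` with
`W` not inside `U`. Members of (3) and (4) have images of dimension at most `δ` in `X₁ × X₂`, where
(1) and (2) inject. Finally (3) injects into `X₄`, where the image of (4) has dimension at most `δ`.
-/

/-- A linearized polynomial with a nonzero coefficient below `s` and none from `s` on has a kernel
of dimension less than `s`. -/
theorem finrank_ker_linearized_lt {F L V : Type*} [Field F] [Fintype F] [Field L] [Algebra F L]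
    [AddCommGroup V] [Module F V] [FiniteDimensional F V] (ι : V →ₗ[F] L)
    (hι : Function.Injective ι) {t : ℕ} (a : Fin t → L) (ha : a ≠ 0) (s : ℕ)
    (hs : ∀ i : Fin t, s ≤ i → a i = 0) (f : V →ₗ[F] L)
    (hf : ∀ x, f x = ∑ i : Fin t, a i * ι x ^ Fintype.card F ^ (i : ℕ)) :
    finrank F (LinearMap.ker f) < s := by
  classical
  set q := Fintype.card F with hq
  have hq1 : 1 < q := Fintype.one_lt_card
  obtain ⟨i₀, hi₀⟩ : ∃ i, a i ≠ 0 := by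
    by_contra! h
    exact ha (funext h)
  have hi₀s : (i₀ : ℕ) < s := by
    by_contra! h
    exact hi₀ (hs i₀ h)
  let p : L[X] := ∑ i : Fin t, C (a i) * X ^ q ^ (i : ℕ)
  have hcoeff : p.coeff (q ^ (i₀ : ℕ)) = a i₀ := by
    simp only [p, finsetSum_coeff, coeff_C_mul, coeff_X_pow]
    rw [Finset.sum_eq_single i₀]
    · simp
    · intro b _ hb
      rw [if_neg, mul_zero]
      intro h
      exact hb (Fin.ext (Nat.pow_right_injective hq1 h).symm)
    · simp
  have hp : p ≠ 0 := by
    intro h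
    rw [h, coeff_zero] at hcoeff
    exact hi₀ hcoeff.symm
  -- `hi₀s` makes `s` positive, so `s - 1` is genuine. The `q ^ dim` kernel elements are roots of
  -- `p`, which bounds the dimension by `s - 1`.
  have hdeg : p.natDegree ≤ q ^ (s - 1) := by
    refine natDegree_sum_le_of_forall_le _ _ fun i _ => ?_
    by_cases h : s ≤ (i : ℕ)
    · simp [hs i h]
    · refine (natDegree_C_mul_X_pow_le _ _).trans (Nat.pow_le_pow_right hq1.le ?_)
      omega
  have hfin : Finite V := Module.finite_of_finite F
  have hcard : Nat.card (LinearMap.ker f) ≤ p.natDegree := by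
    let g : LinearMap.ker f → p.roots.toFinset := fun x => ⟨ι x, by
      rw [Multiset.mem_toFinset, mem_roots hp, IsRoot.def]
      have := x.2
      rw [LinearMap.mem_ker, hf] at this
      simpa [p, eval_finsetSum] using this⟩
    have hg : Function.Injective g := fun x y h =>
      Subtype.ext (hι (congrArg Subtype.val h))
    calc Nat.card (LinearMap.ker f) ≤ Nat.card p.roots.toFinset := Nat.card_le_card_of_injective g hg
      _ = p.roots.toFinset.card := by rw [Nat.card_eq_fintype_card, Fintype.card_coe]
      _ ≤ p.roots.card := Multiset.toFinset_card_le _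
      _ ≤ p.natDegree := p.card_roots'
  rw [Module.natCard_eq_pow_finrank (K := F), Nat.card_eq_fintype_card, ← hq] at hcard
  have := (Nat.pow_le_pow_iff_right hq1).1 (hcard.trans hdeg)
  omega

/-- Gabidulin codes: a linear family of `N × m` matrices over a finite field, in which the nonzero
members with the coefficients from `s` on equal to zero have a kernel of dimension less than `s`. -/
theorem exists_gabidulin (F : Type*) [Field F] [Fintype F] {m N : ℕ} (hmN : m ≤ N) (t : ℕ) :
    ∃ Φ : (Fin t → Fin N → F) →ₗ[F] ((Fin m → F) →ₗ[F] (Fin N → F)),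
      ∀ c, c ≠ 0 → ∀ s : ℕ, (∀ i : Fin t, s ≤ i → c i = 0) →
        finrank F (LinearMap.ker (Φ c)) < s := by
  -- A field extension of degree `N` needs `N ≠ 0`; for `N = 0` there is no nonzero `c`.
  rcases Nat.eq_zero_or_pos N with rfl | hN
  · exact ⟨0, fun c hc => (hc (Subsingleton.elim _ _)).elim⟩
  obtain ⟨p, hp⟩ := CharP.exists F
  have : Fact p.Prime := ⟨CharP.char_is_prime F p⟩
  have : NeZero N := ⟨hN.ne'⟩
  let L := FiniteField.Extension F p N
  have hL : finrank F L = N := FiniteField.finrank_extension F p N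
  let κ : (Fin N → F) ≃ₗ[F] L := LinearEquiv.ofFinrankEq _ _ (by simp [hL])
  let ι : (Fin m → F) →ₗ[F] L :=
    κ.toLinearMap ∘ₗ Function.ExtendByZero.linearMap F (Fin.castLE hmN)
  have hι : Function.Injective ι := by
    refine κ.injective.comp fun x y h => ?_
    funext i
    have : Function.extend (Fin.castLE hmN) x 0 (Fin.castLE hmN i) =
        Function.extend (Fin.castLE hmN) y 0 (Fin.castLE hmN i) := congrFun h _
    rwa [(Fin.castLE_injective hmN).extend_apply, (Fin.castLE_injective hmN).extend_apply] at this
  -- With `F ^ N` identified with the extension `L`, `c` acts as the linearized polynomial `∑ cᵢ x ^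
  -- (q ^ i)` on an embedded copy of `F ^ m`. Frobenius powers are `F`-linear, which gives linearity
  -- in `x`.
  let Φ : (Fin t → Fin N → F) →ₗ[F] ((Fin m → F) →ₗ[F] (Fin N → F)) :=
    LinearMap.mk₂ F (fun c x => κ.symm
        (∑ i : Fin t, κ (c i) * ((FiniteField.frobeniusAlgHom F L) ^ (i : ℕ)) (ι x)))
      (fun c c' x => by simp [add_mul, Finset.sum_add_distrib])
      (fun r c x => by simp [Finset.smul_sum])
      (fun c x y => by simp [mul_add, Finset.sum_add_distrib])
      (fun r c x => by simp [Finset.smul_sum])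
  refine ⟨Φ, fun c hc s hs => ?_⟩
  have hker : LinearMap.ker (Φ c) = LinearMap.ker (κ.toLinearMap ∘ₗ Φ c) := by
    rw [LinearMap.ker_comp_of_ker_eq_bot _ κ.ker]
  rw [hker]
  refine finrank_ker_linearized_lt ι hι (fun i => κ (c i)) ?_ s ?_ _ ?_
  · intro h
    refine hc (funext fun i => κ.injective ?_)
    simpa using congrFun h i
  · intro i hi
    simp [hs i hi]
  · intro x
    simp [Φ, FiniteField.coe_frobeniusAlgHom, pow_iterate]

end SubspaceCode

/-! ### Counting subspaces with Gaussian binomials -/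

namespace SubspaceCode

open Module

section Counting

variable {F V : Type*} [Field F] [Fintype F] [AddCommGroup V] [Module F V] [FiniteDimensional F V]

/-- The tuples that are linearly independent modulo a subspace. -/
theorem card_linearIndependent_mkQ (W : Submodule F V) {i : ℕ} (hi : i ≤ finrank F (V ⧸ W)) :
    Nat.card {v : Fin i → V // LinearIndependent F (W.mkQ ∘ v)} =
      Nat.card W ^ i * ∏ t : Fin i, (Fintype.card F ^ finrank F (V ⧸ W) - Fintype.card F ^ t.val) := by
  have hfin : Finite V := Module.finite_of_finite F
  have hfin' : Finite (V ⧸ W) := Module.finite_of_finite F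
  obtain ⟨g, hg⟩ := W.mkQ.exists_rightInverse_of_surjective W.range_mkQ
  have hg' : ∀ x, W.mkQ (g x) = x := fun x => LinearMap.congr_fun hg x
  -- The section `g` splits each vector into its class modulo `W` and an arbitrary remainder in `W`.
  let e : {v : Fin i → V // LinearIndependent F (W.mkQ ∘ v)} ≃
      (Fin i → W) × {u : Fin i → V ⧸ W // LinearIndependent F u} :=
    { toFun := fun v => (fun k => ⟨v.1 k - g (W.mkQ (v.1 k)), by
          rw [← Submodule.Quotient.mk_eq_zero, ← Submodule.mkQ_apply, map_sub, hg', sub_self]⟩,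
        ⟨W.mkQ ∘ v.1, v.2⟩)
      invFun := fun p => ⟨fun k => p.1 k + g (p.2.1 k), by
        convert p.2.2 using 1
        funext k
        have : W.mkQ (p.1 k : V) = 0 := by simp
        simp only [Function.comp_apply, map_add, hg', this, zero_add]⟩
      left_inv := fun v => by
        ext k
        simp
      right_inv := fun p => by
        have key : ∀ k, W.mkQ ((p.1 k : V) + g (p.2.1 k)) = p.2.1 k := fun k => by
          have : W.mkQ (p.1 k : V) = 0 := by simp
          rw [map_add, hg', this, zero_add]
        refine Prod.ext (funext fun k => Subtype.ext ?_) (Subtype.ext (funext fun k => key k))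
        change (p.1 k : V) + g (p.2.1 k) - g (W.mkQ ((p.1 k : V) + g (p.2.1 k))) = p.1 k
        rw [key, add_sub_cancel_right] }
  rw [Nat.card_congr e, Nat.card_prod, Nat.card_fun, Nat.card_fin, card_linearIndependent hi]

theorem disjoint_span_of_linearIndependent_mkQ {F V : Type*} [Field F] [AddCommGroup V] [Module F V]
    (W : Submodule F V) {i : ℕ} (v : Fin i → V)
    (hv : LinearIndependent F (W.mkQ ∘ v)) : Disjoint (Submodule.span F (Set.range v)) W := by
  rw [Submodule.disjoint_def]
  intro x hx hxW
  obtain ⟨c, rfl⟩ := (Submodule.mem_span_range_iff_exists_fun F).1 hx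
  have h0 : ∑ k, c k • (W.mkQ ∘ v) k = 0 := by
    have : W.mkQ (∑ k, c k • v k) = 0 := (Submodule.Quotient.mk_eq_zero W).2 hxW
    simpa only [map_sum, map_smul, Function.comp_apply] using this
  have := Fintype.linearIndependent_iff.1 hv c h0
  simp [this]

omit [Fintype F] in
theorem extension_of_linearIndependent_mkQ {W D : Submodule F V} (hD : D ≤ W) {i : ℕ}
    (v : Fin i → V) (hv : LinearIndependent F (W.mkQ ∘ v)) :
    finrank F (D ⊔ Submodule.span F (Set.range v) : Submodule F V) = finrank F D + i ∧
      (D ⊔ Submodule.span F (Set.range v)) ⊓ W = D := by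
  have hdis := disjoint_span_of_linearIndependent_mkQ W v hv
  constructor
  · have h := Submodule.finrank_sup_add_finrank_inf_eq D (Submodule.span F (Set.range v))
    rw [(hdis.mono_right hD).symm.eq_bot, finrank_bot, add_zero,
      finrank_span_eq_card hv.of_comp, Fintype.card_fin] at h
    exact h
  · rw [sup_inf_assoc_of_le _ hD, hdis.eq_bot, sup_bot_eq]

/-- `W' ⧸ (W ⊓ W')` embeds in `V ⧸ W`. This lets the fibres of the double count below be counted
inside `W'`. -/
theorem linearIndependent_mkQ_comap_iff {F V : Type*} [Field F] [AddCommGroup V] [Module F V]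
    (W W' : Submodule F V) {i : ℕ} (u : Fin i → W') :
    LinearIndependent F ((W.comap W'.subtype).mkQ ∘ u) ↔
      LinearIndependent F (W.mkQ ∘ fun k => (u k : V)) := by
  let g : W' →ₗ[F] V ⧸ W := W.mkQ ∘ₗ W'.subtype
  have hg : LinearMap.ker g = W.comap W'.subtype := by
    rw [LinearMap.ker_comp, Submodule.ker_mkQ]
  rw [← LinearMap.linearIndependent_iff ((W.comap W'.subtype).liftQ g hg.ge)
    (Submodule.ker_liftQ_eq_bot' _ _ hg.symm)]
  rfl

/-- Double count of the subspaces that meet `W` in the prescribed subspace `D`. -/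
theorem card_extension_mul {W D : Submodule F V} (hD : D ≤ W) {i : ℕ}
    (hi : i ≤ finrank F (V ⧸ W)) :
    Nat.card {W' : Submodule F V // finrank F W' = finrank F D + i ∧ W' ⊓ W = D} *
        (Nat.card D ^ i * ∏ t : Fin i, (Fintype.card F ^ i - Fintype.card F ^ t.val)) =
      Nat.card W ^ i *
        ∏ t : Fin i, (Fintype.card F ^ finrank F (V ⧸ W) - Fintype.card F ^ t.val) := by
  classical
  have hfin : Finite V := Module.finite_of_finite F
  rw [← card_linearIndependent_mkQ W hi]
  let f : {v : Fin i → V // LinearIndependent F (W.mkQ ∘ v)} →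
      {W' : Submodule F V // finrank F W' = finrank F D + i ∧ W' ⊓ W = D} :=
    fun v => ⟨D ⊔ Submodule.span F (Set.range v.1), extension_of_linearIndependent_mkQ hD v.1 v.2⟩
  have := Fintype.ofFinite {W' : Submodule F V // finrank F W' = finrank F D + i ∧ W' ⊓ W = D}
  rw [← Nat.card_congr (Equiv.sigmaFiberEquiv f), Nat.card_sigma]
  -- The fibre over `W'` is the set of `i`-tuples of `W'` independent modulo `W' ⊓ W = D`, so the
  -- same tuple count applies with `W'` and `D` in place of `V` and `W`.
  have hfib : ∀ W' : {W' : Submodule F V // finrank F W' = finrank F D + i ∧ W' ⊓ W = D},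
      Nat.card {v // f v = W'} =
        Nat.card D ^ i * ∏ t : Fin i, (Fintype.card F ^ i - Fintype.card F ^ t.val) := by
    rintro ⟨W', hW'd, hW'D⟩
    have e1 : (W.comap W'.subtype) ≃ₗ[F] D := by
      refine (Submodule.equivMapOfInjective W'.subtype W'.injective_subtype _).trans
        (LinearEquiv.ofEq _ _ ?_)
      rw [Submodule.map_comap_subtype, hW'D]
    have hq : finrank F (W' ⧸ W.comap W'.subtype) = i := by
      have := Submodule.finrank_quotient_add_finrank (W.comap W'.subtype)
      rw [e1.finrank_eq] at this
      omega
    have hc := card_linearIndependent_mkQ (W.comap W'.subtype) hq.ge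
    rw [hq, Nat.card_congr e1.toEquiv] at hc
    rw [← hc]
    refine Nat.card_congr
      { toFun := fun v => ⟨fun k => ⟨v.1.1 k, ?_⟩, ?_⟩
        invFun := fun u => ⟨⟨fun k => u.1 k, (linearIndependent_mkQ_comap_iff W W' u.1).1 u.2⟩, ?_⟩
        left_inv := fun v => rfl
        right_inv := fun u => rfl }
    · have h : D ⊔ Submodule.span F (Set.range v.1.1) = W' := congrArg Subtype.val v.2
      exact h.le (Submodule.mem_sup_right (Submodule.subset_span ⟨k, rfl⟩))
    · exact (linearIndependent_mkQ_comap_iff W W' _).2 v.1.2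
    · have hu := (linearIndependent_mkQ_comap_iff W W' u.1).1 u.2
      refine Subtype.ext (Submodule.eq_of_le_of_finrank_eq ?_ ?_)
      · refine sup_le (hW'D ▸ inf_le_left) (Submodule.span_le.2 ?_)
        rintro _ ⟨k, rfl⟩
        exact (u.1 k).2
      · rw [hW'd]
        exact (extension_of_linearIndependent_mkQ hD _ hu).1
  rw [Finset.sum_congr rfl fun W' _ => hfib W', Finset.sum_const, Finset.card_univ,
    Nat.card_eq_fintype_card, smul_eq_mul]

theorem cast_prod_pow_sub {q n k : ℕ} (hq : 1 ≤ q) (hk : k ≤ n) :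
    ((∏ t : Fin k, (q ^ n - q ^ t.val) : ℕ) : ℚ) =
      ∏ i ∈ Finset.range k, ((q : ℚ) ^ n - (q : ℚ) ^ i) := by
  rw [Finset.prod_range, Nat.cast_prod]
  refine Finset.prod_congr rfl fun t _ => ?_
  rw [Nat.cast_sub (Nat.pow_le_pow_right hq (t.2.le.trans hk))]
  push_cast
  rfl

theorem card_extension {W D : Submodule F V} (hD : D ≤ W) {i : ℕ}
    (hi : i ≤ finrank F (V ⧸ W)) :
    (Nat.card {W' : Submodule F V // finrank F W' = finrank F D + i ∧ W' ⊓ W = D} : ℚ) =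
      (Fintype.card F : ℚ) ^ ((finrank F W - finrank F D) * i) *
        gaussBinom (Fintype.card F) (finrank F (V ⧸ W)) i := by
  have hq1 : 1 < Fintype.card F := Fintype.one_lt_card
  have h := congrArg (Nat.cast : ℕ → ℚ) (card_extension_mul hD hi)
  rw [Nat.cast_mul, Nat.cast_mul, Nat.cast_mul, cast_prod_pow_sub hq1.le le_rfl,
    cast_prod_pow_sub hq1.le hi, Module.natCard_eq_pow_finrank (K := F) (V := D),
    Module.natCard_eq_pow_finrank (K := F) (V := W), Nat.card_eq_fintype_card (α := F)] at h
  set q := Fintype.card F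
  have hq0 : (0 : ℚ) < q := by exact_mod_cast hq1.le
  have hP : ∏ t ∈ Finset.range i, ((q : ℚ) ^ i - (q : ℚ) ^ t) ≠ 0 := by
    refine Finset.prod_ne_zero_iff.2 fun t ht => sub_ne_zero.2 ?_
    exact (pow_lt_pow_right₀ (by exact_mod_cast hq1) (Finset.mem_range.1 ht)).ne'
  rw [gaussBinom, Finset.prod_div_distrib, mul_div_assoc', eq_div_iff hP]
  have hDW := Submodule.finrank_mono hD
  have hpow : (q : ℚ) ^ (finrank F W * i) =
      q ^ (finrank F D * i) * q ^ ((finrank F W - finrank F D) * i) := by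
    rw [← pow_add, ← add_mul, Nat.add_sub_cancel' hDW]
  push_cast at h
  rw [← pow_mul, ← pow_mul, hpow] at h
  have hne : (q : ℚ) ^ (finrank F D * i) ≠ 0 := by positivity
  apply mul_left_cancel₀ hne
  linear_combination h

/-- The Gaussian binomial coefficient counts subspaces. -/
theorem card_subspaces {k : ℕ} (hk : k ≤ finrank F V) :
    (Nat.card {W : Submodule F V // finrank F W = k} : ℚ) =
      gaussBinom (Fintype.card F) (finrank F V) k := by
  have hb : finrank F (V ⧸ (⊥ : Submodule F V)) = finrank F V :=
    (Submodule.quotEquivOfEqBot ⊥ rfl).finrank_eq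
  have h := card_extension (le_refl (⊥ : Submodule F V)) (hk.trans hb.ge)
  rw [hb, finrank_bot, tsub_self, zero_mul, pow_zero, one_mul] at h
  rw [← h]
  congr 1
  refine Nat.card_congr (Equiv.subtypeEquivRight fun W => ?_)
  simp

theorem gaussBinom_nonneg {q n k : ℕ} (hq : 1 < q) (hk : k ≤ n) : 0 ≤ gaussBinom q n k := by
  have hq' : (1 : ℚ) ≤ q := by exact_mod_cast hq.le
  refine Finset.prod_nonneg fun i hi => div_nonneg ?_ ?_ <;>
    refine sub_nonneg.2 (pow_le_pow_right₀ hq' ?_)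
  · exact (Finset.mem_range.1 hi).le.trans hk
  · exact (Finset.mem_range.1 hi).le

end Counting

/-- Taking annihilators matches `k`-dimensional subspaces with `(n - k)`-dimensional subspaces of
the dual, and both sides count subspaces. -/
theorem gaussBinom_symm (F : Type*) [Field F] [Fintype F] {n k : ℕ} (hk : k ≤ n) :
    gaussBinom (Fintype.card F) n (n - k) = gaussBinom (Fintype.card F) n k := by
  have hn : finrank F (Fin n → F) = n := by simp
  have hd : finrank F (Dual F (Fin n → F)) = n := by rw [Subspace.dual_finrank_eq, hn]
  have h1 := card_subspaces (F := F) (V := Fin n → F) (hk.trans hn.ge)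
  have h2 := card_subspaces (F := F) (V := Dual F (Fin n → F)) ((Nat.sub_le n k).trans hd.ge)
  rw [hn] at h1
  rw [hd] at h2
  rw [← h1, ← h2]
  congr 1
  refine (Nat.card_congr (Equiv.subtypeEquiv
    ((Subspace.orderIsoFiniteDimensional (K := F) (V := Fin n → F)).toEquiv.trans
      OrderDual.ofDual) fun W => ?_)).symm
  have h := Subspace.finrank_add_finrank_dualAnnihilator_eq W
  rw [hn] at h
  change finrank F W = k ↔ finrank F W.dualAnnihilator = n - k
  omega

end SubspaceCode

/-! ### Greedy choice of subspaces avoiding the codewords -/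

namespace SubspaceCode

open Module

/-- A finite set contains a subset of pairwise `r`-unrelated elements such that every element of the
set is `r`-related to one of them. -/
theorem exists_maximal_pairwise_not {α : Type*} (A : Finset α) (r : α → α → Prop)
    (hr : ∀ a ∈ A, r a a) (hsymm : ∀ a b, r a b → r b a) :
    ∃ T ⊆ A, (∀ a ∈ T, ∀ b ∈ T, a ≠ b → ¬ r a b) ∧ ∀ a ∈ A, ∃ b ∈ T, r a b := by
  classical
  induction A using Finset.induction_on with
  | empty => exact ⟨∅, le_rfl, by simp, by simp⟩
  | insert x A _ ih =>
    obtain ⟨T, hTA, hT, hcov⟩ := ih fun a ha => hr a (Finset.mem_insert_of_mem ha)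
    by_cases h : ∃ b ∈ T, r x b
    · refine ⟨T, hTA.trans (Finset.subset_insert _ _), hT, fun a ha => ?_⟩
      rcases Finset.mem_insert.1 ha with rfl | ha
      · exact h
      · exact hcov a ha
    · push Not at h
      refine ⟨insert x T, Finset.insert_subset_insert _ hTA, ?_, ?_⟩
      · intro a ha b hb hab
        rcases Finset.mem_insert.1 ha with rfl | ha' <;>
          rcases Finset.mem_insert.1 hb with rfl | hb'
        · exact (hab rfl).elim
        · exact h b hb'
        · exact fun hab' => h a ha' (hsymm _ _ hab')
        · exact hT a ha' b hb' hab
      · intro a ha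
        rcases Finset.mem_insert.1 ha with rfl | ha
        · exact ⟨a, Finset.mem_insert_self _ _, hr a (Finset.mem_insert_self _ _)⟩
        · obtain ⟨b, hb, hab⟩ := hcov a ha
          exact ⟨b, Finset.mem_insert_of_mem hb, hab⟩

section GilbertVarshamov

variable {F V : Type*} [Field F] [Fintype F] [AddCommGroup V] [Module F V] [FiniteDimensional F V]

theorem card_subspaces_le (U : Submodule F V) {k : ℕ} (hk : k ≤ finrank F U) :
    (Nat.card {W : Submodule F V // W ≤ U ∧ finrank F W = k} : ℚ) =
      gaussBinom (Fintype.card F) (finrank F U) k := by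
  rw [← card_subspaces hk]
  congr 1
  refine Nat.card_congr
    { toFun := fun W => ⟨W.1.comap U.subtype, ?_⟩
      invFun := fun W => ⟨W.1.map U.subtype, U.map_subtype_le _, ?_⟩
      left_inv := fun W => Subtype.ext ?_
      right_inv := fun W => Subtype.ext ?_ }
  · exact (Submodule.comapSubtypeEquivOfLe W.2.1).finrank_eq.trans W.2.2
  · rw [(Submodule.equivMapOfInjective U.subtype U.injective_subtype W.1).symm.finrank_eq, W.2]
  · simp [W.2.1]
  · simp [Submodule.comap_map_eq_of_injective U.injective_subtype]

/-- A bound for the number of `m`-dimensional subspaces meeting a given one in at least `m + 1 - y`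
dimensions. -/
theorem card_ball_le {m y : ℕ} (hy : y ≤ m + 1) (W : Submodule F V) (hW : finrank F W = m)
    (hym : y ≤ finrank F V - m + 1) (S : Finset (Submodule F V))
    (hS : ∀ W' ∈ S, finrank F W' = m ∧ m + 1 ≤ finrank F (W' ⊓ W : Submodule F V) + y) :
    (S.card : ℚ) ≤ ∑ i ∈ Finset.range y, (Fintype.card F : ℚ) ^ (i ^ 2) *
      gaussBinom (Fintype.card F) m i * gaussBinom (Fintype.card F) (finrank F V - m) i := by
  classical
  have hfin : Finite V := Module.finite_of_finite F
  have := Fintype.ofFinite (Submodule F V)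
  have hq : finrank F (V ⧸ W) = finrank F V - m := by rw [W.finrank_quotient, hW]
  -- Sort by `D = W' ⊓ W` and its codimension `i` in `W`: there are `[m, i]` choices of `D`, and
  -- `card_extension` gives `q ^ (i * i) * [dim V - m, i]` spaces `W'` for each.
  have hsub : S ⊆ (Finset.range y).biUnion fun i =>
      (Finset.univ.filter fun D : Submodule F V => D ≤ W ∧ finrank F D = m - i).biUnion fun D =>
        Finset.univ.filter fun W' : Submodule F V => finrank F W' = finrank F D + i ∧ W' ⊓ W = D := by
    intro W' hW'
    obtain ⟨h1, h2⟩ := hS W' hW'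
    have h3 : finrank F (W' ⊓ W : Submodule F V) ≤ m := hW ▸ Submodule.finrank_mono inf_le_right
    simp only [Finset.mem_biUnion, Finset.mem_range, Finset.mem_filter, Finset.mem_univ, true_and]
    exact ⟨m - finrank F (W' ⊓ W : Submodule F V), by omega, W' ⊓ W,
      ⟨inf_le_right, by omega⟩, by omega, rfl⟩
  refine (Nat.cast_le.2 ((Finset.card_le_card hsub).trans Finset.card_biUnion_le)).trans ?_
  rw [Nat.cast_sum]
  refine Finset.sum_le_sum fun i hi => ?_
  have hi := Finset.mem_range.1 hi
  refine (Nat.cast_le.2 (Finset.card_biUnion_le)).trans (le_of_eq ?_)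
  rw [Nat.cast_sum, Finset.sum_congr rfl (g := fun _ => (Fintype.card F : ℚ) ^ (i ^ 2) *
    gaussBinom (Fintype.card F) (finrank F V - m) i)]
  · rw [Finset.sum_const, nsmul_eq_mul]
    have h := card_subspaces_le W (k := m - i) (by omega)
    rw [Nat.card_eq_fintype_card, Fintype.card_subtype, hW, gaussBinom_symm F (by omega)] at h
    rw [h]
    ring
  · intro D hD
    obtain ⟨hDW, hD⟩ := (Finset.mem_filter.1 hD).2
    have h := card_extension hDW (i := i) (by omega)
    rw [Nat.card_eq_fintype_card, Fintype.card_subtype, hW, hD, hq,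
      show m - (m - i) = i by omega, ← sq] at h
    rw [← h, hD]

/-- The greedy construction of a set of subspaces that are not contained in any codeword. -/
theorem exists_avoiding_code {δ : ℕ} (hδ : 2 ≤ δ) (hV : finrank F V = 4 * δ)
    (C : Finset (Submodule F V)) (hC : ∀ U ∈ C, finrank F U = 2 * δ) :
    ∃ T : Finset (Submodule F V), (∀ W ∈ T, finrank F W = δ + 1 ∧ ∀ U ∈ C, ¬ W ≤ U) ∧
      (∀ W ∈ T, ∀ W' ∈ T, W ≠ W' → finrank F (W ⊓ W' : Submodule F V) ≤ 1) ∧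
      numN (Fintype.card F) (4 * δ) δ (2 * δ) C.card ≤ T.card := by
  classical
  have hfin : Finite V := Module.finite_of_finite F
  have := Fintype.ofFinite (Submodule F V)
  have hq1 : 1 < Fintype.card F := Fintype.one_lt_card
  let all : Finset (Submodule F V) := Finset.univ.filter fun W => finrank F W = δ + 1
  let bad : Finset (Submodule F V) := C.biUnion fun U =>
    Finset.univ.filter fun W => W ≤ U ∧ finrank F W = δ + 1
  obtain ⟨T, hTA, hT, hcov⟩ := exists_maximal_pairwise_not (all \ bad)
    (fun W W' => 2 ≤ finrank F (W ⊓ W' : Submodule F V))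
    (fun W hW => by
      have : finrank F W = δ + 1 := (Finset.mem_filter.1 (Finset.mem_sdiff.1 hW).1).2
      rw [inf_idem]
      omega)
    (fun W W' h => by rwa [inf_comm])
  have hall : ∀ W ∈ all \ bad, finrank F W = δ + 1 := fun W hW =>
    (Finset.mem_filter.1 (Finset.mem_sdiff.1 hW).1).2
  refine ⟨T, fun W hW => ⟨hall W (hTA hW), fun U hU hWU => ?_⟩, fun W hW W' hW' hne => ?_, ?_⟩
  · refine (Finset.mem_sdiff.1 (hTA hW)).2 (Finset.mem_biUnion.2 ⟨U, hU, ?_⟩)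
    simp [hWU, hall W (hTA hW)]
  · have := hT W hW W' hW' hne
    omega
  have hbad : (bad.card : ℚ) ≤ C.card * gaussBinom (Fintype.card F) (2 * δ) (δ - 1) := by
    refine (Nat.cast_le.2 Finset.card_biUnion_le).trans (le_of_eq ?_)
    have hsymm := gaussBinom_symm F (n := 2 * δ) (k := δ - 1) (by omega)
    rw [show 2 * δ - (δ - 1) = δ + 1 by omega] at hsymm
    rw [Nat.cast_sum, Finset.sum_congr rfl (g := fun _ =>
      gaussBinom (Fintype.card F) (2 * δ) (δ - 1)), Finset.sum_const, nsmul_eq_mul]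
    intro U hU
    have h := card_subspaces_le U (k := δ + 1) (by rw [hC U hU]; omega)
    rw [Nat.card_eq_fintype_card, Fintype.card_subtype, hC U hU, hsymm] at h
    rw [← h]
  have hallc : (all.card : ℚ) = gaussBinom (Fintype.card F) (4 * δ) (δ + 1) := by
    have h := card_subspaces (F := F) (V := V) (k := δ + 1) (by omega)
    rwa [Nat.card_eq_fintype_card, Fintype.card_subtype, hV] at h
  have hdiff : (all.card : ℚ) ≤ (all \ bad).card + bad.card := by
    exact_mod_cast Finset.card_le_card_sdiff_add_card
  set den : ℚ := ∑ i ∈ Finset.range δ, (Fintype.card F : ℚ) ^ (i ^ 2) *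
    gaussBinom (Fintype.card F) (δ + 1) i * gaussBinom (Fintype.card F) (4 * δ - (δ + 1)) i
  have hden : 0 ≤ den := by
    refine Finset.sum_nonneg fun i hi => ?_
    have hi := Finset.mem_range.1 hi
    have h1 := gaussBinom_nonneg (n := δ + 1) (k := i) hq1 (by omega)
    have h2 := gaussBinom_nonneg (n := 4 * δ - (δ + 1)) (k := i) hq1 (by omega)
    positivity
  -- By maximality the balls around members of `T` cover everything not excluded. With `m = δ + 1`
  -- and `y = δ`, the ball condition says precisely that the intersection has dimension at least 2.
  have hcovc : ((all \ bad).card : ℚ) ≤ T.card * den := by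
    have hsub : all \ bad ⊆ T.biUnion fun W =>
        (all \ bad).filter fun W' => 2 ≤ finrank F (W' ⊓ W : Submodule F V) := fun W' hW' => by
      obtain ⟨W, hW, h⟩ := hcov W' hW'
      exact Finset.mem_biUnion.2 ⟨W, hW, Finset.mem_filter.2 ⟨hW', h⟩⟩
    refine (Nat.cast_le.2 ((Finset.card_le_card hsub).trans Finset.card_biUnion_le)).trans ?_
    rw [Nat.cast_sum, ← nsmul_eq_mul]
    refine Finset.sum_le_card_nsmul _ _ _ fun W hW => ?_
    have h := card_ball_le (m := δ + 1) (y := δ) (by omega) W (hall W (hTA hW)) (by omega)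
      ((all \ bad).filter fun W' => 2 ≤ finrank F (W' ⊓ W : Submodule F V)) (fun W' hW' => by
        obtain ⟨h1, h2⟩ := Finset.mem_filter.1 hW'
        exact ⟨hall W' h1, by omega⟩)
    rwa [hV] at h
  have hfinal : numN (Fintype.card F) (4 * δ) δ (2 * δ) C.card ≤ ⌊(T.card : ℚ)⌋ := by
    rw [numN, show 2 * δ - δ + 1 = δ + 1 by omega]
    refine Int.floor_le_floor (div_le_of_le_mul₀ hden (by positivity) ?_)
    linarith
  simpa using hfinal

end GilbertVarshamov

end SubspaceCode

/-! ### Separated families, lifting and block graphs -/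

namespace SubspaceCode

open Module

/-- An indexed family of `2δ`-dimensional subspaces, any two of which with distinct indices meet in
dimension at most `δ`. -/
structure IsSeparated {F E I : Type*} [Field F] [AddCommGroup E] [Module F E] (δ : ℕ)
    (V : I → Submodule F E) : Prop where
  finrank_eq : ∀ x, finrank F (V x) = 2 * δ
  finrank_inf_le : ∀ x y, x ≠ y → finrank F (V x ⊓ V y : Submodule F E) ≤ δ

section Geometry

variable {F E X Y Z K : Type*} [Field F] [AddCommGroup E] [Module F E] [FiniteDimensional F E]
  [AddCommGroup X] [Module F X] [FiniteDimensional F X] [AddCommGroup Y] [Module F Y]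
  [FiniteDimensional F Y] [AddCommGroup Z] [Module F Z] [FiniteDimensional F Z]
  [AddCommGroup K] [Module F K] [FiniteDimensional F K]

-- `p` is injective on `V`, hence on the intersection. Only one of the spaces has to avoid the
-- kernel, which makes the bound usable between families of different shape.
omit [FiniteDimensional F E] in
theorem finrank_inf_le_finrank_map_inf (p : E →ₗ[F] X) (V V' : Submodule F E)
    (hV : Disjoint V (LinearMap.ker p)) :
    finrank F (V ⊓ V' : Submodule F E) ≤ finrank F (V.map p ⊓ V'.map p : Submodule F X) := by
  let g : (V ⊓ V' : Submodule F E) →ₗ[F] (V.map p ⊓ V'.map p : Submodule F X) :=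
    (p ∘ₗ (V ⊓ V').subtype).codRestrict _ fun x =>
      ⟨Submodule.mem_map_of_mem x.2.1, Submodule.mem_map_of_mem x.2.2⟩
  refine LinearMap.finrank_le_finrank_of_injective (f := g) ?_
  rw [← LinearMap.ker_eq_bot, LinearMap.ker_eq_bot']
  intro x hx
  have h : p x = 0 := congrArg Subtype.val hx
  exact Subtype.ext (Submodule.disjoint_def.1 hV x x.2.1 h)

-- If `φ x = φ' y`, applying `p` forces `x = y`, so common points come from the kernel of the
-- difference.
omit [FiniteDimensional F E] [FiniteDimensional F X] in
theorem finrank_range_inf_range_le (p : E →ₗ[F] X) (φ φ' : K →ₗ[F] E)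
    (hp : p ∘ₗ φ = p ∘ₗ φ') (hinj : Function.Injective (p ∘ₗ φ)) :
    finrank F (LinearMap.range φ ⊓ LinearMap.range φ' : Submodule F E) ≤
      finrank F (LinearMap.ker (φ - φ')) := by
  have h : LinearMap.range φ ⊓ LinearMap.range φ' ≤ (LinearMap.ker (φ - φ')).map φ := by
    rintro _ ⟨⟨x, rfl⟩, y, hy⟩
    have hxy : x = y := hinj (by
      rw [LinearMap.comp_apply, ← hy, ← LinearMap.comp_apply, ← hp])
    exact ⟨x, by rw [SetLike.mem_coe, LinearMap.mem_ker, LinearMap.sub_apply, ← hy, hxy, sub_self],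
      rfl⟩
  exact (Submodule.finrank_mono h).trans (Submodule.finrank_map_le _ _)

omit [FiniteDimensional F E] [FiniteDimensional F Y] [FiniteDimensional F Z] in
/-- Lifting: graphs of linear maps over the members of a separated family. -/
theorem exists_lifted_family {δ : ℕ} {I J : Type*} (p : E →ₗ[F] X) (ι : X →ₗ[F] E) (κ : Y →ₗ[F] E)
    (hpι : p ∘ₗ ι = LinearMap.id) (hpκ : p ∘ₗ κ = 0) (hκ : Function.Injective κ)
    {U : J → Submodule F X} (hU : IsSeparated δ U) (f : I → (Fin (2 * δ) → F) →ₗ[F] Y)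
    (hf : ∀ c c', c ≠ c' → finrank F (LinearMap.ker (f c - f c')) ≤ δ) :
    ∃ V : J × I → Submodule F E, IsSeparated δ V ∧
      (∀ x, Disjoint (V x) (LinearMap.ker p) ∧ (V x).map p = U x.1) ∧
      ∀ r : E →ₗ[F] Z, r ∘ₗ ι = 0 → ∀ x, finrank F ((V x).map r) ≤
        finrank F (LinearMap.range (f x.2)) := by
  let e : ∀ j, (Fin (2 * δ) → F) ≃ₗ[F] U j := fun j =>
    LinearEquiv.ofFinrankEq _ _ (by rw [hU.finrank_eq]; simp)
  let ψ : J → (Fin (2 * δ) → F) →ₗ[F] X := fun j => (U j).subtype ∘ₗ (e j).toLinearMap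
  -- The range of `φ` is the graph: `p` recovers the base `U j`, while `κ` places the matrix part in
  -- the kernel of `p`.
  let φ : J × I → (Fin (2 * δ) → F) →ₗ[F] E := fun x => ι ∘ₗ ψ x.1 + κ ∘ₗ f x.2
  have hpφ : ∀ x, p ∘ₗ φ x = ψ x.1 := fun x => LinearMap.ext fun y => by
    have h₁ : p (ι (ψ x.1 y)) = ψ x.1 y := LinearMap.congr_fun hpι _
    have h₂ : p (κ (f x.2 y)) = 0 := LinearMap.congr_fun hpκ _
    change p (ι (ψ x.1 y) + κ (f x.2 y)) = ψ x.1 y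
    rw [map_add, h₁, h₂, add_zero]
  have hinj : ∀ x, Function.Injective (p ∘ₗ φ x) := fun x => by
    rw [hpφ]
    exact (U x.1).injective_subtype.comp (e x.1).injective
  have hinjφ : ∀ x, Function.Injective (φ x) := fun x => by
    have := hinj x
    rw [LinearMap.coe_comp] at this
    exact this.of_comp
  have hdis : ∀ x, Disjoint (LinearMap.range (φ x)) (LinearMap.ker p) := fun x => by
    rw [Submodule.disjoint_def]
    rintro _ ⟨y, rfl⟩ hy
    have : y = 0 := hinj x (by rw [map_zero]; exact hy)
    rw [this, map_zero]
  have hmap : ∀ x, (LinearMap.range (φ x)).map p = U x.1 := fun x => by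
    rw [← LinearMap.range_comp, hpφ, LinearMap.range_comp, LinearEquiv.range, Submodule.map_top,
      Submodule.range_subtype]
  refine ⟨fun x => LinearMap.range (φ x), ⟨fun x => ?_, fun x y hxy => ?_⟩,
    fun x => ⟨hdis x, hmap x⟩, fun r hr x => ?_⟩
  · rw [LinearMap.finrank_range_of_inj (hinjφ x)]
    simp
  · by_cases h : x.1 = y.1
    · refine (finrank_range_inf_range_le p (φ x) (φ y) ?_ (hinj x)).trans ?_
      · rw [hpφ, hpφ, h]
      · have hsub : φ x - φ y = κ ∘ₗ (f x.2 - f y.2) := by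
          simp only [φ, h, LinearMap.comp_sub, add_sub_add_left_eq_sub]
        rw [hsub, LinearMap.ker_comp_of_ker_eq_bot _ (LinearMap.ker_eq_bot.2 hκ)]
        exact hf _ _ fun h2 => hxy (Prod.ext h h2)
    · refine (finrank_inf_le_finrank_map_inf p _ _ (hdis x)).trans ?_
      rw [hmap, hmap]
      exact hU.finrank_inf_le _ _ h
  · have : r ∘ₗ φ x = (r ∘ₗ κ) ∘ₗ f x.2 := by
      rw [LinearMap.comp_add, ← LinearMap.comp_assoc, hr, LinearMap.zero_comp, zero_add,
        LinearMap.comp_assoc]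
    rw [← LinearMap.range_comp, this, LinearMap.range_comp]
    exact Submodule.finrank_map_le _ _

omit [FiniteDimensional F X] [FiniteDimensional F Y] in
theorem finrank_submodule_prod (P : Submodule F X) (Q : Submodule F Y)
    [FiniteDimensional F P] [FiniteDimensional F Q] :
    finrank F (P.prod Q) = finrank F P + finrank F Q := by
  have h : P.prod Q = LinearMap.range (P.subtype.prodMap Q.subtype) := by
    rw [LinearMap.range_prodMap, Submodule.range_subtype, Submodule.range_subtype]
  rw [h, LinearMap.finrank_range_of_inj, Module.finrank_prod]
  exact P.injective_subtype.prodMap Q.injective_subtype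

theorem isSeparated_prod {δ : ℕ} {I : Type*} {P : I → Submodule F X} {Q : I → Submodule F Y}
    (hP : ∀ x, finrank F (P x) = δ) (hQ : ∀ x, finrank F (Q x) = δ)
    (h : ∀ x y, x ≠ y → finrank F (P x ⊓ P y : Submodule F X) +
      finrank F (Q x ⊓ Q y : Submodule F Y) ≤ δ) :
    IsSeparated δ fun x => (P x).prod (Q x) := by
  refine ⟨fun x => ?_, fun x y hxy => ?_⟩
  · rw [finrank_submodule_prod, hP, hQ, two_mul]
  · rw [Submodule.prod_inf_prod, finrank_submodule_prod]
    exact h x y hxy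

/-- The map whose matrix is `(0 | 1 | f)`, the identity block starting at column `s`. -/
def blockGraph {r δ : ℕ} (s : ℕ) (f : (Fin δ → F) →ₗ[F] (Fin (r - (s + δ)) → F)) :
    (Fin δ → F) →ₗ[F] (Fin r → F) :=
  LinearMap.pi fun k =>
    if h₁ : k < s then 0
    else if h₂ : k < s + δ then LinearMap.proj ⟨k - s, by omega⟩
    else LinearMap.proj ⟨k - (s + δ), by omega⟩ ∘ₗ f

/-- The `δ` columns starting at column `s`. -/
def blockProj (F : Type*) [Field F] {r δ s : ℕ} (hs : s + δ ≤ r) :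
    (Fin r → F) →ₗ[F] (Fin δ → F) :=
  LinearMap.funLeft F F fun k => ⟨s + k, by omega⟩

theorem blockProj_comp_blockGraph {r δ s : ℕ} (hs : s + δ ≤ r)
    (f : (Fin δ → F) →ₗ[F] (Fin (r - (s + δ)) → F)) :
    blockProj F hs ∘ₗ blockGraph s f = LinearMap.id := by
  refine LinearMap.ext fun x => funext fun k => ?_
  simp [blockProj, blockGraph, LinearMap.funLeft_apply]

theorem blockProj_comp_blockGraph_of_le {r δ s s' : ℕ} (hs : s + δ ≤ r) (hss : s + δ ≤ s')
    (f : (Fin δ → F) →ₗ[F] (Fin (r - (s' + δ)) → F)) :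
    blockProj F hs ∘ₗ blockGraph s' f = 0 := by
  refine LinearMap.ext fun x => funext fun k => ?_
  have : s + (k : ℕ) < s' := by omega
  simp [blockProj, blockGraph, LinearMap.funLeft_apply, this]

theorem finrank_range_blockGraph {r δ s : ℕ} (hs : s + δ ≤ r)
    (f : (Fin δ → F) →ₗ[F] (Fin (r - (s + δ)) → F)) :
    finrank F (LinearMap.range (blockGraph s f)) = δ := by
  rw [LinearMap.finrank_range_of_inj, Module.finrank_fin_fun]
  intro x y h
  have := congrArg (blockProj F hs) h
  rwa [← LinearMap.comp_apply, ← LinearMap.comp_apply, blockProj_comp_blockGraph] at this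

theorem finrank_range_blockGraph_inf_le {r δ s : ℕ} (hs : s + δ ≤ r)
    (f f' : (Fin δ → F) →ₗ[F] (Fin (r - (s + δ)) → F)) :
    finrank F (LinearMap.range (blockGraph s f) ⊓ LinearMap.range (blockGraph s f') :
      Submodule F (Fin r → F)) ≤ finrank F (LinearMap.ker (f - f')) := by
  refine (finrank_range_inf_range_le (blockProj F hs) _ _ ?_ ?_).trans (Submodule.finrank_mono ?_)
  · rw [blockProj_comp_blockGraph, blockProj_comp_blockGraph]
  · rw [blockProj_comp_blockGraph]
    exact fun _ _ h => h
  · intro x hx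
    rw [LinearMap.mem_ker] at hx ⊢
    funext k
    have := congrFun hx ⟨s + δ + k, by omega⟩
    have h₁ : ¬ s + δ + (k : ℕ) < s := by omega
    simpa [blockGraph, h₁] using this

/-- The columns of the earlier identity block read off `x` on the first range and vanish on the
second. -/
theorem range_blockGraph_inf_eq_bot {r δ s s' : ℕ} (hs : s + δ ≤ r) (hss : s + δ ≤ s')
    (f : (Fin δ → F) →ₗ[F] (Fin (r - (s + δ)) → F))
    (f' : (Fin δ → F) →ₗ[F] (Fin (r - (s' + δ)) → F)) :
    LinearMap.range (blockGraph s f) ⊓ LinearMap.range (blockGraph s' f') = ⊥ := by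
  rw [eq_bot_iff]
  rintro _ ⟨⟨x, rfl⟩, y, hy⟩
  have := congrArg (blockProj F hs) hy
  rw [← LinearMap.comp_apply, ← LinearMap.comp_apply, blockProj_comp_blockGraph,
    blockProj_comp_blockGraph_of_le hs hss] at this
  have hx : x = 0 := this.symm
  simp [hx]

end Geometry

end SubspaceCode

/-! ### Rank-metric codes: words of low rank and pairs of cosets -/

namespace SubspaceCode

open Module

section Families

variable (F : Type*) [Field F] [Fintype F]

/-- A family of matrices of rank distance at least `δ`. -/
theorem exists_rank_metric_family {δ N : ℕ} (hN : 2 * δ ≤ N) :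
    ∃ Φ : (Fin (δ + 1) → Fin N → F) →ₗ[F] ((Fin (2 * δ) → F) →ₗ[F] (Fin N → F)),
      (∀ c, c ≠ 0 → finrank F (LinearMap.ker (Φ c)) ≤ δ) ∧
      ∀ c c', c ≠ c' → finrank F (LinearMap.ker (Φ c - Φ c')) ≤ δ := by
  obtain ⟨Φ, hΦ⟩ := exists_gabidulin F hN (δ + 1)
  have h : ∀ c, c ≠ 0 → finrank F (LinearMap.ker (Φ c)) ≤ δ := fun c hc =>
    Nat.lt_succ_iff.1 (hΦ c hc (δ + 1) fun i hi => by omega)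
  exact ⟨Φ, h, fun c c' hc => by rw [← map_sub]; exact h _ (sub_ne_zero.2 hc)⟩

/-- The number of codewords of rank at most `δ`. -/
theorem card_rank_le {δ N : ℕ}
    (Φ : (Fin (δ + 1) → Fin N → F) →ₗ[F] ((Fin (2 * δ) → F) →ₗ[F] (Fin N → F)))
    (hΦ : ∀ c, c ≠ 0 → finrank F (LinearMap.ker (Φ c)) ≤ δ) :
    1 + gaussBinom (Fintype.card F) (2 * δ) δ * ((Fintype.card F : ℚ) ^ N - 1) ≤
      Nat.card {c // finrank F (LinearMap.range (Φ c)) ≤ δ} := by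
  classical
  have hK : finrank F (Fin (2 * δ) → F) = 2 * δ := by simp
  let R (D : Submodule F (Fin (2 * δ) → F)) :
      (Fin (δ + 1) → Fin N → F) →ₗ[F] (D →ₗ[F] (Fin N → F)) :=
    (LinearMap.lcomp F (Fin N → F) D.subtype) ∘ₗ Φ
  have hR : ∀ D c, c ∈ LinearMap.ker (R D) → D ≤ LinearMap.ker (Φ c) := fun D c hc x hx =>
    LinearMap.congr_fun (LinearMap.mem_ker.1 hc) ⟨x, hx⟩
  let 𝒟 := {D : Submodule F (Fin (2 * δ) → F) // finrank F D = δ}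
  -- Restriction to `D` maps a space of dimension `(δ + 1) * N` to one of dimension `δ * N`.
  have hker : ∀ D : 𝒟, N ≤ finrank F (LinearMap.ker (R D.1)) := fun D => by
    have h1 := (R D.1).finrank_range_add_finrank_ker
    have h2 := Submodule.finrank_le (LinearMap.range (R D.1))
    rw [Module.finrank_linearMap, D.2] at h2
    simp only [Module.finrank_pi_fintype, Module.finrank_self, Finset.sum_const, Finset.card_univ,
      Fintype.card_fin, smul_eq_mul, mul_one] at h1 h2
    rw [add_mul, one_mul] at h1
    omega
  have : Fintype 𝒟 := Fintype.ofFinite _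
  let g : Option (Σ D : 𝒟, {c : LinearMap.ker (R D.1) // c ≠ 0}) →
      {c // finrank F (LinearMap.range (Φ c)) ≤ δ} := fun o => match o with
    | none => ⟨0, by
        rw [map_zero, LinearMap.range_zero, finrank_bot]
        exact Nat.zero_le _⟩
    | some ⟨D, c⟩ => ⟨c.1, by
        have h1 := (Φ c.1).finrank_range_add_finrank_ker
        have h2 := Submodule.finrank_mono (hR D.1 c.1 c.1.2)
        rw [D.2] at h2
        rw [hK] at h1
        omega⟩
  have hne : ∀ (D : 𝒟) (c : {c : LinearMap.ker (R D.1) // c ≠ 0}),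
      (c.1 : Fin (δ + 1) → Fin N → F) ≠ 0 := fun D c h => c.2 (Subtype.ext h)
  -- A nonzero codeword has kernel of dimension at most `δ`, so one vanishing on `D` has kernel
  -- exactly `D`. Different `D` thus contribute disjoint sets of nonzero words, and `none` stands
  -- for the zero word.
  have hD : ∀ (D : 𝒟) (c : {c : LinearMap.ker (R D.1) // c ≠ 0}),
      D.1 = LinearMap.ker (Φ c.1) := fun D c =>
    Submodule.eq_of_le_of_finrank_le (hR D.1 c.1 c.1.2) (D.2.symm ▸ hΦ _ (hne D c))
  have hg : Function.Injective g := by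
    rintro (_ | ⟨D, c⟩) (_ | ⟨D', c'⟩) h
    · rfl
    · exact (hne D' c' (congrArg Subtype.val h).symm).elim
    · exact (hne D c (congrArg Subtype.val h)).elim
    · have hcc : (c.1 : Fin (δ + 1) → Fin N → F) = c'.1 := congrArg Subtype.val h
      have hDD : D = D' := Subtype.ext (by rw [hD D c, hD D' c', hcc])
      subst hDD
      have : c = c' := Subtype.ext (Subtype.ext hcc)
      rw [this]
  have hcard := Nat.card_le_card_of_injective g hg
  have h𝒟 : (Fintype.card 𝒟 : ℚ) = gaussBinom (Fintype.card F) (2 * δ) δ := by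
    have h := card_subspaces (F := F) (V := Fin (2 * δ) → F) (k := δ) (by omega)
    rwa [Nat.card_eq_fintype_card, hK] at h
  have hfib : ∀ D : 𝒟, Fintype.card F ^ N - 1 ≤ Nat.card {c : LinearMap.ker (R D.1) // c ≠ 0} := by
    intro D
    have h : Nat.card {c : LinearMap.ker (R D.1) // c ≠ 0} =
        Fintype.card F ^ finrank F (LinearMap.ker (R D.1)) - 1 := by
      rw [Nat.card_eq_fintype_card, Fintype.card_subtype_compl, Fintype.card_subtype_eq,
        Module.card_eq_pow_finrank (K := F)]
    rw [h]
    exact Nat.sub_le_sub_right (Nat.pow_le_pow_right Fintype.card_pos (hker D)) 1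
  rw [Finite.card_option, Nat.card_sigma] at hcard
  have hsum := Finset.sum_le_sum fun (D : 𝒟) (_ : D ∈ Finset.univ) => hfib D
  rw [Finset.sum_const, Finset.card_univ, smul_eq_mul] at hsum
  have hfinal : 1 + Fintype.card 𝒟 * (Fintype.card F ^ N - 1) ≤
      Nat.card {c // finrank F (LinearMap.range (Φ c)) ≤ δ} := by omega
  rw [← h𝒟]
  have hq : 1 ≤ Fintype.card F ^ N := Nat.one_le_pow _ _ Fintype.card_pos
  have := (Nat.cast_le (α := ℚ)).2 hfinal
  rw [Nat.cast_add, Nat.cast_mul, Nat.cast_sub hq] at this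
  exact_mod_cast this

/-- Pairing the cosets of two codes of rank distance `δ` in codes of rank distances `δ - d₂` and
`δ - d₁`. -/
theorem exists_coset_pairs {δ a b d₁ d₂ m : ℕ} (hd : d₁ + d₂ = δ) (ha : δ ≤ a) (hb : δ ≤ b)
    (hm₂ : m ≤ a * d₂) (hm₁ : m ≤ b * d₁) :
    ∃ (f : Fin (Fintype.card F ^ m) × (Fin a → F) × (Fin b → F) →
        (Fin δ → F) →ₗ[F] (Fin a → F))
      (g : Fin (Fintype.card F ^ m) × (Fin a → F) × (Fin b → F) →
        (Fin δ → F) →ₗ[F] (Fin b → F)),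
      ∀ x y, x ≠ y → finrank F (LinearMap.ker (f x - f y)) +
        finrank F (LinearMap.ker (g x - g y)) ≤ δ := by
  have hq : 0 < Fintype.card F := Fintype.card_pos
  have hemb : ∀ n d : ℕ, m ≤ n * d →
      Nonempty (Fin (Fintype.card F ^ m) ↪ (Fin d → Fin n → F)) := fun n d h => by
    apply Function.Embedding.nonempty_of_card_le
    simp only [Fintype.card_fin, Fintype.card_fun]
    rw [← pow_mul]
    exact Nat.pow_le_pow_right hq h
  obtain ⟨e₂⟩ := hemb a d₂ hm₂
  obtain ⟨e₁⟩ := hemb b d₁ hm₁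
  obtain ⟨Φ, hΦ⟩ := exists_gabidulin F ha (d₂ + 1)
  obtain ⟨Ψ, hΨ⟩ := exists_gabidulin F hb (d₁ + 1)
  -- The higher coefficients label the coset, with one label `x.1` shared by both sides; the
  -- coefficient of index 0 picks the word inside the coset.
  refine ⟨fun x => Φ (Fin.cons x.2.1 (e₂ x.1)), fun x => Ψ (Fin.cons x.2.2 (e₁ x.1)), ?_⟩
  have hle : ∀ {n : ℕ} (f : (Fin δ → F) →ₗ[F] (Fin n → F)),
      finrank F (LinearMap.ker f) ≤ δ := fun f => by
    simpa using Submodule.finrank_le (LinearMap.ker f)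
  have key : ∀ {n d : ℕ} (x y : Fin n → F) (e e' : Fin d → Fin n → F), e ≠ e' →
      (Fin.cons x e - Fin.cons y e' : Fin (d + 1) → Fin n → F) ≠ 0 := fun x y e e' h h0 =>
    h (funext fun i => by simpa [sub_eq_zero] using congrFun h0 i.succ)
  have key' : ∀ {n d : ℕ} (x y : Fin n → F) (e : Fin d → Fin n → F), x ≠ y →
      (Fin.cons x e - Fin.cons y e : Fin (d + 1) → Fin n → F) ≠ 0 := fun x y e h h0 =>
    h (by simpa [sub_eq_zero] using congrFun h0 0)
  have key0 : ∀ {n d : ℕ} (x y : Fin n → F) (e : Fin d → Fin n → F) (i : Fin (d + 1)),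
      1 ≤ (i : ℕ) → (Fin.cons x e - Fin.cons y e : Fin (d + 1) → Fin n → F) i = 0 :=
    fun x y e i hi => by
      obtain ⟨j, rfl⟩ := Fin.exists_succ_eq.2 (show i ≠ 0 by rintro rfl; simp at hi)
      simp
  rintro ⟨c, x, z⟩ ⟨c', x', z'⟩ hne
  dsimp only
  rw [← map_sub, ← map_sub]
  -- With equal labels, the differences involve only the coefficient of index 0; the one that is
  -- nonzero has trivial kernel, and the other kernel has dimension at most `δ`. With different
  -- labels the kernels have dimension at most `d₂` and `d₁`, which add up to `δ`.
  by_cases hc : c = c'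
  · subst hc
    by_cases hx : x = x'
    · have hz : z ≠ z' := fun hz => hne (by rw [hx, hz])
      have h1 := hΨ _ (key' z z' (e₁ c) hz) 1 (key0 z z' (e₁ c))
      have h2 := hle (Φ (Fin.cons x (e₂ c) - Fin.cons x' (e₂ c)))
      omega
    · have h1 := hΦ _ (key' x x' (e₂ c) hx) 1 (key0 x x' (e₂ c))
      have h2 := hle (Ψ (Fin.cons z (e₁ c) - Fin.cons z' (e₁ c)))
      omega
  · have h1 := hΦ _ (key x x' _ _ (e₂.injective.ne hc)) (d₂ + 1) fun i hi => by omega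
    have h2 := hΨ _ (key z z' _ _ (e₁.injective.ne hc)) (d₁ + 1) fun i hi => by omega
    omega

/-- Makes the subtraction in `dTwo` genuine, so that the two distances add up to `δ`. -/
theorem dOne_le {δ h i j : ℕ} : dOne δ h i j ≤ δ := by
  have h1 : ⌈(δ : ℚ) / 2⌉₊ ≤ δ := Nat.ceil_le.2 (half_le_self (by positivity))
  rw [dOne]
  split_ifs
  · exact h1
  · exact (Nat.floor_le_ceil _).trans h1

/-- The direct sums of graphs coming from the coset construction. -/
theorem exists_coset_family {δ h J : ℕ} (hδ : 2 ≤ δ) (hJ : J * δ ≤ h + 1) :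
    ∃ (P : (Σ ij : Fin 3 × Fin J, Fin (Fintype.card F ^
          (min (((4 - (ij.1 : ℕ)) * δ - 1) * dTwo δ h ij.1 ij.2)
            ((h + 1 - ij.2 * δ) * dOne δ h ij.1 ij.2))) ×
          (Fin (5 * δ - 1 - (ij.1 * δ + δ)) → F) × (Fin (δ + h + 1 - (ij.2 * δ + δ)) → F)) →
          Submodule F (Fin (5 * δ - 1) → F))
      (Q : (Σ ij : Fin 3 × Fin J, Fin (Fintype.card F ^
          (min (((4 - (ij.1 : ℕ)) * δ - 1) * dTwo δ h ij.1 ij.2)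
            ((h + 1 - ij.2 * δ) * dOne δ h ij.1 ij.2))) ×
          (Fin (5 * δ - 1 - (ij.1 * δ + δ)) → F) × (Fin (δ + h + 1 - (ij.2 * δ + δ)) → F)) →
          Submodule F (Fin (δ + h + 1) → F)),
      (∀ x, finrank F (P x) = δ) ∧ (∀ x, finrank F (Q x) = δ) ∧
      ∀ x y, x ≠ y → finrank F (P x ⊓ P y : Submodule F (Fin (5 * δ - 1) → F)) +
        finrank F (Q x ⊓ Q y : Submodule F (Fin (δ + h + 1) → F)) ≤ δ := by
  have hi3 : ∀ i : Fin 3, (i : ℕ) * δ + 2 * δ ≤ 4 * δ := fun i => by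
    rw [← add_mul]
    exact Nat.mul_le_mul_right _ (by omega)
  have hjJ : ∀ j : Fin J, (j : ℕ) * δ + δ ≤ h + 1 := fun j => by
    refine le_trans ?_ hJ
    rw [← Nat.succ_mul]
    exact Nat.mul_le_mul_right _ j.2
  have hi4 : ∀ i : Fin 3, (4 - (i : ℕ)) * δ - 1 = 5 * δ - 1 - (i * δ + δ) := fun i => by
    rw [Nat.sub_mul]
    omega
  have hpair := fun ij : Fin 3 × Fin J =>
    exists_coset_pairs F (δ := δ) (a := 5 * δ - 1 - (ij.1 * δ + δ))
      (b := δ + h + 1 - (ij.2 * δ + δ)) (d₁ := dOne δ h ij.1 ij.2) (d₂ := dTwo δ h ij.1 ij.2)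
      (m := min (((4 - (ij.1 : ℕ)) * δ - 1) * dTwo δ h ij.1 ij.2)
            ((h + 1 - ij.2 * δ) * dOne δ h ij.1 ij.2))
      (Nat.add_sub_cancel' dOne_le) (by have := hi3 ij.1; omega) (by have := hjJ ij.2; omega)
      (by rw [hi4]; exact min_le_left _ _)
      (by
        rw [show δ + h + 1 - (ij.2 * δ + δ) = h + 1 - ij.2 * δ by omega]
        exact min_le_right _ _)
  choose f g hfg using hpair
  have hs : ∀ i : Fin 3, (i : ℕ) * δ + δ ≤ 5 * δ - 1 := fun i => by
    have := hi3 i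
    omega
  have ht : ∀ j : Fin J, (j : ℕ) * δ + δ ≤ δ + h + 1 := fun j => by
    have := hjJ j
    omega
  have hlt : ∀ {i i' : ℕ}, i < i' → i * δ + δ ≤ i' * δ := fun {i i'} hii => by
    rw [← Nat.succ_mul]
    exact Nat.mul_le_mul_right _ hii
  refine ⟨fun x => LinearMap.range (blockGraph (x.1.1 * δ) (f x.1 x.2)),
    fun x => LinearMap.range (blockGraph (x.1.2 * δ) (g x.1 x.2)),
    fun x => finrank_range_blockGraph (hs _) _, fun x => finrank_range_blockGraph (ht _) _, ?_⟩
  rintro ⟨⟨i, j⟩, x⟩ ⟨⟨i', j'⟩, x'⟩ hne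
  dsimp only
  have hP1 := finrank_range_blockGraph (hs i) (f (i, j) x)
  have hQ1 := finrank_range_blockGraph (ht j) (g (i, j) x)
  have hP := Submodule.finrank_mono (inf_le_left (a := LinearMap.range
    (blockGraph (i * δ) (f (i, j) x))) (b := LinearMap.range (blockGraph (i' * δ) (f (i', j') x'))))
  have hQ := Submodule.finrank_mono (inf_le_left (a := LinearMap.range
    (blockGraph (j * δ) (g (i, j) x))) (b := LinearMap.range (blockGraph (j' * δ) (g (i', j') x'))))
  -- Different block positions on either side make that intersection zero, and the other has
  -- dimension at most `δ`. Equal positions on both sides reduce to the coset pairs.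
  rcases lt_trichotomy i i' with hii | rfl | hii
  · rw [range_blockGraph_inf_eq_bot (hs i) (hlt hii), finrank_bot]
    omega
  · rcases lt_trichotomy j j' with hjj | rfl | hjj
    · rw [range_blockGraph_inf_eq_bot (ht j) (hlt hjj), finrank_bot]
      omega
    · have hxx : x ≠ x' := fun h => hne (by rw [h])
      refine (add_le_add (finrank_range_blockGraph_inf_le (hs i) _ _)
        (finrank_range_blockGraph_inf_le (ht j) _ _)).trans (hfg (i, j) x x' hxx)
    · rw [inf_comm (LinearMap.range (blockGraph (j * δ) _)),
        range_blockGraph_inf_eq_bot (ht j') (hlt hjj), finrank_bot]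
      omega
  · rw [inf_comm (LinearMap.range (blockGraph (i * δ) _)),
      range_blockGraph_inf_eq_bot (hs i') (hlt hii), finrank_bot]
    omega

end Families

end SubspaceCode

/-! ### Codes as separated families, and the union of the four families -/

namespace SubspaceCode

open Module

section Assembly

variable {F : Type*} [Field F]

theorem IsSeparated.sumElim {E I I' : Type*} [AddCommGroup E] [Module F E] {δ : ℕ}
    {V : I → Submodule F E} {V' : I' → Submodule F E} (hV : IsSeparated δ V)
    (hV' : IsSeparated δ V')
    (h : ∀ x y, finrank F (V x ⊓ V' y : Submodule F E) ≤ δ) : IsSeparated δ (Sum.elim V V') where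
  finrank_eq := by rintro (x | x); exacts [hV.finrank_eq x, hV'.finrank_eq x]
  finrank_inf_le := by
    rintro (x | x) (y | y) hxy
    · exact hV.finrank_inf_le x y fun h => hxy (by rw [h])
    · exact h x y
    · rw [inf_comm]
      exact h y x
    · exact hV'.finrank_inf_le x y fun h => hxy (by rw [h])

theorem IsSeparated.map_equiv {E E' I : Type*} [AddCommGroup E] [Module F E] [AddCommGroup E']
    [Module F E'] {δ : ℕ} {V : I → Submodule F E} (hV : IsSeparated δ V) (e : E ≃ₗ[F] E') :
    IsSeparated δ fun x => (V x).map e.toLinearMap where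
  finrank_eq x := by rw [LinearEquiv.finrank_map_eq, hV.finrank_eq]
  finrank_inf_le x y hxy := by
    rw [← Submodule.map_inf _ e.injective, LinearEquiv.finrank_map_eq]
    exact hV.finrank_inf_le x y hxy

theorem IsCDC.isSeparated {n δ : ℕ} {C : Finset (Submodule F (Fin n → F))}
    (hC : IsCDC n (2 * δ) (2 * δ) C) : IsSeparated δ fun U : C => U.1 where
  finrank_eq U := hC.dim_eq U.1 U.2
  finrank_inf_le U U' h := by
    have h1 := hC.dist_ge U.1 U.2 U'.1 U'.2 fun h' => h (Subtype.ext h')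
    have h2 := Submodule.finrank_sup_add_finrank_inf_eq U.1 U'.1
    rw [hC.dim_eq U.1 U.2, hC.dim_eq U'.1 U'.2] at h2
    rw [subspaceDist] at h1
    omega

theorem bddAbove_card_isCDC [Fintype F] (n d k : ℕ) :
    BddAbove {M : ℕ | ∃ C : Finset (Submodule F (Fin n → F)), IsCDC n d k C ∧ C.card = M} := by
  classical
  have := Fintype.ofFinite (Submodule F (Fin n → F))
  refine ⟨Fintype.card (Submodule F (Fin n → F)), ?_⟩
  rintro _ ⟨C, -, rfl⟩
  exact Finset.card_le_univ C

/-- Equal spaces at distinct indices would meet in dimension `2δ > δ`, so the family is injective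
and its index set has the size of the code. -/
theorem IsSeparated.card_le_maxCDCSize [Fintype F] {E I : Type*} [AddCommGroup E] [Module F E]
    [FiniteDimensional F E] [Finite I] (x₀ : I) {n δ : ℕ} (hδ : 1 ≤ δ) (hE : finrank F E = n)
    {V : I → Submodule F E} (hV : IsSeparated δ V) :
    Nat.card I ≤ maxCDCSize F n (2 * δ) (2 * δ) := by
  classical
  have := Fintype.ofFinite I
  let e : E ≃ₗ[F] (Fin n → F) := LinearEquiv.ofFinrankEq _ _ (by simp [hE])
  have hW := hV.map_equiv e
  set W := fun x => (V x).map e.toLinearMap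
  have hinj : Function.Injective W := fun x y h => by
    by_contra hxy
    have h1 := hW.finrank_inf_le x y hxy
    rw [← h, inf_idem, hW.finrank_eq] at h1
    omega
  refine le_csSup (bddAbove_card_isCDC n _ _) ⟨Finset.univ.image W, ⟨?_, ?_, ?_⟩, ?_⟩
  · exact ⟨W x₀, Finset.mem_image_of_mem W (Finset.mem_univ x₀)⟩
  · simp only [Finset.mem_image, Finset.mem_univ, true_and, forall_exists_index,
      forall_apply_eq_imp_iff]
    exact hW.finrank_eq
  · simp only [Finset.mem_image, Finset.mem_univ, true_and, forall_exists_index,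
      forall_apply_eq_imp_iff]
    intro x y hxy
    have h1 := hW.finrank_inf_le x y fun h => hxy (by rw [h])
    have h2 := Submodule.finrank_sup_add_finrank_inf_eq (W x) (W y)
    rw [hW.finrank_eq, hW.finrank_eq] at h2
    rw [subspaceDist]
    omega
  · rw [Finset.card_image_of_injective _ hinj, Finset.card_univ, Nat.card_eq_fintype_card]

/-- A nonempty bounded set of naturals contains its supremum; a single coordinate subspace is
already a code. -/
theorem exists_isCDC_card_eq_maxCDCSize [Fintype F] {n d k : ℕ} (hk : k ≤ n) :
    ∃ C : Finset (Submodule F (Fin n → F)), IsCDC n d k C ∧ C.card = maxCDCSize F n d k := by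
  refine Nat.sSup_mem ?_ (bddAbove_card_isCDC n d k)
  refine ⟨1, {LinearMap.range (Function.ExtendByZero.linearMap F (Fin.castLE hk))}, ⟨?_, ?_, ?_⟩,
    Finset.card_singleton _⟩
  · exact Finset.singleton_nonempty _
  · intro U hU
    rw [Finset.mem_singleton.1 hU, LinearMap.finrank_range_of_inj, Module.finrank_fin_fun]
    intro x y h
    funext i
    have : Function.extend (Fin.castLE hk) x 0 (Fin.castLE hk i) =
        Function.extend (Fin.castLE hk) y 0 (Fin.castLE hk i) := congrFun h _
    rwa [(Fin.castLE_injective hk).extend_apply, (Fin.castLE_injective hk).extend_apply] at this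
  · intro U hU V hV hUV
    exact (hUV ((Finset.mem_singleton.1 hU).trans (Finset.mem_singleton.1 hV).symm)).elim

section Union

variable {X₁ X₂ X₃ X₄ I₁ I₂ I₃ I₄ : Type*} [AddCommGroup X₁] [Module F X₁] [FiniteDimensional F X₁]
  [AddCommGroup X₂] [Module F X₂] [FiniteDimensional F X₂]
  [AddCommGroup X₃] [Module F X₃] [FiniteDimensional F X₃]
  [AddCommGroup X₄] [Module F X₄] [FiniteDimensional F X₄]

/-- Families of subspaces of `(X₁ × X₂) × (X₃ × X₄)`, distinguished by their projections to `X₁`,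
`X₁ × X₂` and `X₄`, have a separated union. -/
theorem isSeparated_union {δ : ℕ} {V₁ : I₁ → Submodule F ((X₁ × X₂) × (X₃ × X₄))}
    {V₂ : I₂ → Submodule F ((X₁ × X₂) × (X₃ × X₄))}
    {V₃ : I₃ → Submodule F ((X₁ × X₂) × (X₃ × X₄))}
    {V₄ : I₄ → Submodule F ((X₁ × X₂) × (X₃ × X₄))}
    {U : I₁ → Submodule F X₁} {W : I₂ → Submodule F X₁}
    (h₁ : IsSeparated δ V₁) (h₂ : IsSeparated δ V₂) (h₃ : IsSeparated δ V₃) (h₄ : IsSeparated δ V₄)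
    (hU : ∀ x, Disjoint (V₁ x) (LinearMap.ker (LinearMap.fst F X₁ X₂ ∘ₗ LinearMap.fst F _ _)) ∧
      (V₁ x).map (LinearMap.fst F X₁ X₂ ∘ₗ LinearMap.fst F _ _) = U x)
    (hW : ∀ x, Disjoint (V₂ x) (LinearMap.ker (LinearMap.fst F _ _)) ∧
      (V₂ x).map (LinearMap.fst F _ _) = (W x).prod ⊤)
    (hUW : ∀ x y, finrank F (U x ⊓ W y : Submodule F X₁) ≤ δ)
    (hV₃ : ∀ x, Disjoint (V₃ x) (LinearMap.ker (LinearMap.snd F X₃ X₄ ∘ₗ LinearMap.snd F _ _)))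
    (hV₃' : ∀ x, finrank F ((V₃ x).map (LinearMap.fst F _ _)) ≤ δ)
    (hV₄ : ∀ x, finrank F ((V₄ x).map (LinearMap.snd F X₃ X₄ ∘ₗ LinearMap.snd F _ _)) ≤ δ)
    (hV₄' : ∀ x, finrank F ((V₄ x).map (LinearMap.fst F _ _)) ≤ δ) :
    IsSeparated δ (Sum.elim V₁ (Sum.elim V₂ (Sum.elim V₃ V₄))) := by
  -- `h1` and `h2` separate the first two families from any space with a small image in `X₁ × X₂`,
  -- as the last two families have.
  have h1 : ∀ x (V : Submodule F ((X₁ × X₂) × (X₃ × X₄))),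
      finrank F (V.map (LinearMap.fst F _ _)) ≤ δ →
      finrank F (V₁ x ⊓ V : Submodule F ((X₁ × X₂) × (X₃ × X₄))) ≤ δ := fun x V hV => by
    refine (finrank_inf_le_finrank_map_inf _ _ V (hU x).1).trans
      ((Submodule.finrank_mono inf_le_right).trans ?_)
    rw [Submodule.map_comp]
    exact (Submodule.finrank_map_le _ _).trans hV
  have h2 : ∀ x (V : Submodule F ((X₁ × X₂) × (X₃ × X₄))),
      finrank F (V.map (LinearMap.fst F _ _)) ≤ δ →
      finrank F (V₂ x ⊓ V : Submodule F ((X₁ × X₂) × (X₃ × X₄))) ≤ δ := fun x V hV =>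
    (finrank_inf_le_finrank_map_inf _ _ V (hW x).1).trans
      ((Submodule.finrank_mono inf_le_right).trans hV)
  refine h₁.sumElim (h₂.sumElim (h₃.sumElim h₄ fun x y => ?_) fun x y => ?_) fun x y => ?_
  · exact (finrank_inf_le_finrank_map_inf _ _ _ (hV₃ x)).trans
      ((Submodule.finrank_mono inf_le_right).trans (hV₄ y))
  · rcases y with y | y
    exacts [h2 x _ (hV₃' y), h2 x _ (hV₄' y)]
  · rcases y with y | y | y
    · refine (finrank_inf_le_finrank_map_inf _ _ (V₂ y) (hU x).1).trans ?_
      rw [(hU x).2, Submodule.map_comp, (hW y).2, Submodule.prod_map_fst]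
      exact hUW x y
    · exact h1 x _ (hV₃' y)
    · exact h1 x _ (hV₄' y)

end Union

end Assembly

end SubspaceCode

/-! ### Construction of the families and the final count -/

namespace SubspaceCode

open Module

theorem sum_Icc_eq_card_sigma {q : ℕ} {n J : ℕ} (m a b : ℕ → ℕ → ℕ) {F : Type*} [Fintype F]
    (hq : Fintype.card F = q) :
    (Nat.card (Σ ij : Fin (n + 1) × Fin (J + 1), Fin (q ^ m ij.1 ij.2) ×
      (Fin (a ij.1 ij.2) → F) × (Fin (b ij.1 ij.2) → F)) : ℚ) =
    ∑ i ∈ Finset.Icc 0 n, ∑ j ∈ Finset.Icc 0 J, (q : ℚ) ^ m i j * (q : ℚ) ^ (a i j + b i j) := by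
  classical
  rw [Nat.card_sigma, Fintype.sum_prod_type, ← Nat.range_succ_eq_Icc_zero, Finset.sum_range,
    Nat.cast_sum]
  refine Finset.sum_congr rfl fun i _ => ?_
  rw [← Nat.range_succ_eq_Icc_zero, Finset.sum_range, Nat.cast_sum]
  refine Finset.sum_congr rfl fun j _ => ?_
  simp [hq, pow_add]

/-- The size of the union of the four families of codewords. -/
theorem card_families_le_maxCDCSize {F : Type*} [Field F] [Fintype F] {δ h J : ℕ} (hδ : 2 ≤ δ)
    (hh : δ - 1 ≤ h) (hJ : (J + 1) * δ ≤ h + 1) {C : Finset (Submodule F (Fin (4 * δ) → F))}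
    (hC : IsCDC (4 * δ) (2 * δ) (2 * δ) C) {T : Finset (Submodule F (Fin (4 * δ) → F))}
    (hTC : ∀ W ∈ T, finrank F W = δ + 1 ∧ ∀ U ∈ C, ¬ W ≤ U)
    (hT : ∀ W ∈ T, ∀ W' ∈ T, W ≠ W' →
      finrank F (W ⊓ W' : Submodule F (Fin (4 * δ) → F)) ≤ 1) :
    (C.card : ℚ) * (Fintype.card F : ℚ) ^ ((2 * δ + h) * (δ + 1)) +
      T.card * (Fintype.card F : ℚ) ^ ((δ + h + 1) * (δ + 1)) +
      (1 + gaussBinom (Fintype.card F) (2 * δ) δ * ((Fintype.card F : ℚ) ^ (4 * δ + h) - 1)) +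
      ∑ i ∈ Finset.Icc 0 2, ∑ j ∈ Finset.Icc 0 J,
        (Fintype.card F : ℚ) ^ (min (((4 - i) * δ - 1) * dTwo δ h i j)
            ((h + 1 - j * δ) * dOne δ h i j)) *
          (Fintype.card F : ℚ) ^ ((5 * δ - 1 - (i * δ + δ)) + (δ + h + 1 - (j * δ + δ))) ≤
      (maxCDCSize F (6 * δ + h) (2 * δ) (2 * δ) : ℚ) := by
  classical
  obtain ⟨Φ₁, -, hΦ₁⟩ := exists_rank_metric_family F (δ := δ) (N := 2 * δ + h) (by omega)
  obtain ⟨Φ₂, -, hΦ₂⟩ := exists_rank_metric_family F (δ := δ) (N := δ + h + 1) (by omega)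
  obtain ⟨Φ₃, hΦ₃', hΦ₃⟩ := exists_rank_metric_family F (δ := δ) (N := 4 * δ + h) (by omega)
  obtain ⟨P, Q, hP, hQ, hPQ⟩ := exists_coset_family F hδ hJ
  let X₁ := Fin (4 * δ) → F
  let X₂ := Fin (δ - 1) → F
  let X₃ := Fin (h + 1 - δ) → F
  let X₄ := Fin (2 * δ) → F
  let E := (X₁ × X₂) × (X₃ × X₄)
  have hX₁ : finrank F X₁ = 4 * δ := Module.finrank_fin_fun F
  have hX₂ : finrank F X₂ = δ - 1 := Module.finrank_fin_fun F
  have hX₃ : finrank F X₃ = h + 1 - δ := Module.finrank_fin_fun F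
  have hX₄ : finrank F X₄ = 2 * δ := Module.finrank_fin_fun F
  have hA : finrank F (X₁ × X₂) = 5 * δ - 1 := by rw [Module.finrank_prod]; omega
  have hB : finrank F (X₃ × X₄) = δ + h + 1 := by rw [Module.finrank_prod]; omega
  have hE : finrank F E = 6 * δ + h := by rw [Module.finrank_prod]; omega
  let e₁ : (Fin (2 * δ + h) → F) ≃ₗ[F] X₂ × (X₃ × X₄) := LinearEquiv.ofFinrankEq _ _ (by
    rw [Module.finrank_prod, Module.finrank_fin_fun]; omega)
  let e₂ : (Fin (δ + h + 1) → F) ≃ₗ[F] X₃ × X₄ := LinearEquiv.ofFinrankEq _ _ (by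
    rw [Module.finrank_fin_fun]; omega)
  let e₃ : (Fin (4 * δ + h) → F) ≃ₗ[F] (X₁ × X₂) × X₃ := LinearEquiv.ofFinrankEq _ _ (by
    rw [Module.finrank_prod, Module.finrank_fin_fun]; omega)
  let eA : (Fin (5 * δ - 1) → F) ≃ₗ[F] X₁ × X₂ := LinearEquiv.ofFinrankEq _ _ (by
    rw [Module.finrank_fin_fun]; omega)
  -- The factor `X₂` raises the dimension from `δ + 1` to `2δ` and the intersections from at most 1
  -- to at most `δ`.
  have hT' : IsSeparated δ fun W : T => (W.1.prod (⊤ : Submodule F X₂)) := by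
    refine ⟨fun W => ?_, fun W W' hne => ?_⟩
    · rw [finrank_submodule_prod, (hTC W.1 W.2).1, finrank_top]
      omega
    · rw [Submodule.prod_inf_prod, inf_top_eq, finrank_submodule_prod, finrank_top]
      have := hT W.1 W.2 W'.1 W'.2 fun h => hne (Subtype.ext h)
      omega
  have hTop : IsSeparated δ fun _ : Unit => (⊤ : Submodule F X₄) :=
    ⟨fun _ => by rw [finrank_top, hX₄], fun x y hxy => (hxy rfl).elim⟩
  obtain ⟨V₁, hV₁, hU, -⟩ := exists_lifted_family (Z := F) (E := E)
    (LinearMap.fst F X₁ X₂ ∘ₗ LinearMap.fst F _ _)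
    (LinearMap.inl F _ _ ∘ₗ LinearMap.inl F X₁ X₂)
    ((LinearMap.inr F X₁ X₂).prodMap LinearMap.id ∘ₗ e₁.toLinearMap) (LinearMap.ext fun _ => rfl)
    (LinearMap.ext fun _ => rfl)
    ((LinearMap.inr_injective.prodMap Function.injective_id).comp e₁.injective)
    hC.isSeparated Φ₁ hΦ₁
  obtain ⟨V₂, hV₂, hW, -⟩ := exists_lifted_family (Z := F) (E := E)
    (LinearMap.fst F (X₁ × X₂) (X₃ × X₄)) (LinearMap.inl F _ _)
    (LinearMap.inr F _ _ ∘ₗ e₂.toLinearMap) (LinearMap.ext fun _ => rfl) (LinearMap.ext fun _ => rfl)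
    (LinearMap.inr_injective.comp e₂.injective) hT' Φ₂ hΦ₂
  -- The only base space is `X₄` itself. Since the maps have rank at most `δ`, `hV₃r` bounds the
  -- image in `X₁ × X₂`.
  obtain ⟨V₃, hV₃, hV₃d, hV₃r⟩ := exists_lifted_family (Z := X₁ × X₂) (E := E)
    (LinearMap.snd F X₃ X₄ ∘ₗ LinearMap.snd F _ _)
    (LinearMap.inr F _ _ ∘ₗ LinearMap.inr F X₃ X₄)
    (LinearMap.id.prodMap (LinearMap.inl F X₃ X₄) ∘ₗ e₃.toLinearMap) (LinearMap.ext fun _ => rfl)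
    (LinearMap.ext fun _ => rfl)
    ((Function.injective_id.prodMap LinearMap.inl_injective).comp e₃.injective)
    hTop (fun c : {c // finrank F (LinearMap.range (Φ₃ c)) ≤ δ} => Φ₃ c.1)
    (fun c c' hc => hΦ₃ _ _ fun h => hc (Subtype.ext h))
  have hV₄ := isSeparated_prod (P := fun x => (P x).map eA.toLinearMap)
    (Q := fun x => (Q x).map e₂.toLinearMap) (fun x => by rw [LinearEquiv.finrank_map_eq, hP])
    (fun x => by rw [LinearEquiv.finrank_map_eq, hQ]) (fun x y hxy => by
      rw [← Submodule.map_inf _ eA.injective, ← Submodule.map_inf _ e₂.injective,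
        LinearEquiv.finrank_map_eq, LinearEquiv.finrank_map_eq]
      exact hPQ x y hxy)
  have hunion := isSeparated_union hV₁ hV₂ hV₃ hV₄ hU hW
    (fun x y => by
      -- An intersection of dimension above `δ` would be all of the `(δ + 1)`-dimensional `W`,
      -- putting `W` inside a codeword.
      by_contra! hlt
      have h0 : δ < finrank F (x.1.1 ⊓ y.1.1 : Submodule F (Fin (4 * δ) → F)) := hlt
      have h1 := (hTC y.1.1 y.1.2).1
      have h2 : x.1.1 ⊓ y.1.1 = y.1.1 :=
        Submodule.eq_of_le_of_finrank_le inf_le_right (by rw [h1]; exact h0)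
      exact (hTC y.1.1 y.1.2).2 x.1.1 x.1.2 (inf_eq_right.1 h2))
    (fun x => (hV₃d x).1)
    (fun x => (hV₃r (LinearMap.fst F _ _) (LinearMap.ext fun _ => rfl) x).trans x.2.2)
    (fun x => by
      rw [Submodule.map_comp, Submodule.prod_map_snd]
      refine (Submodule.finrank_map_le _ _).trans ?_
      rw [LinearEquiv.finrank_map_eq, hQ])
    (fun x => by rw [Submodule.prod_map_fst, LinearEquiv.finrank_map_eq, hP])
  obtain ⟨U₀, hU₀⟩ := hC.nonempty
  have hcard := (Nat.cast_le (α := ℚ)).2 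
    (hunion.card_le_maxCDCSize (Sum.inl (⟨U₀, hU₀⟩, 0)) (by omega) hE)
  refine le_trans ?_ hcard
  have hrank := card_rank_le F Φ₃ hΦ₃'
  rw [Nat.card_sum, Nat.card_sum, Nat.card_sum, Nat.card_prod, Nat.card_prod, Nat.card_prod,
    Nat.cast_add, Nat.cast_add, Nat.cast_add,
    sum_Icc_eq_card_sigma (n := 2)
      (fun i j => min (((4 - i) * δ - 1) * dTwo δ h i j) ((h + 1 - j * δ) * dOne δ h i j))
      (fun i _ => 5 * δ - 1 - (i * δ + δ)) (fun _ j => δ + h + 1 - (j * δ + δ)) rfl]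
  simp only [Nat.card_eq_fintype_card, Fintype.card_coe, Fintype.card_fun, Fintype.card_fin,
    Fintype.card_unit, one_mul, ← pow_mul, Nat.cast_mul, Nat.cast_pow] at hrank ⊢
  linarith

end SubspaceCode

theorem mainTheorem8 {F : Type*} [Field F] [Fintype F] (q : ℕ) (hq : Fintype.card F = q)
    (δ h : ℕ) (hδ : 2 ≤ δ) (hh : δ - 1 ≤ h) :
    (0 < SubspaceCode.numN q (4 * δ) δ (2 * δ) (SubspaceCode.maxCDCSize F (4 * δ) (2 * δ) (2 * δ)) →
      (((SubspaceCode.maxCDCSize F (4 * δ) (2 * δ) (2 * δ)) : ℕ) : ℚ) * (q : ℚ) ^ ((2 * δ + h) * (δ + 1))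
        + (SubspaceCode.numN q (4 * δ) δ (2 * δ) (SubspaceCode.maxCDCSize F (4 * δ) (2 * δ) (2 * δ)) : ℚ) *
            (q : ℚ) ^ (max (δ + h + 1) (2 * δ) * (min (δ + h + 1) (2 * δ) - δ + 1))
        + (1 + SubspaceCode.gaussBinom q (2 * δ) δ * ((q : ℚ) ^ (4 * δ + h) - 1))
        + ∑ i ∈ Finset.Icc 0 2, ∑ j ∈ Finset.Icc 0 (min 1 ((h + 1) / δ - 1)),
            (q : ℚ) ^ (min (((4 - i) * δ - 1) * SubspaceCode.dTwo δ h i j)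
                ((h + 1 - j * δ) * SubspaceCode.dOne δ h i j)) *
              (q : ℚ) ^ ((4 - i) * δ + h - j * δ)
        ≤ (SubspaceCode.maxCDCSize F (6 * δ + h) (2 * δ) (2 * δ) : ℚ)) ∧
    (∀ S : ℕ,
      (∃ C : Finset (Submodule F (Fin (4 * δ) → F)),
        SubspaceCode.IsCDC (4 * δ) (2 * δ) (2 * δ) C ∧ C.card = S) →
      0 < SubspaceCode.numN q (4 * δ) δ (2 * δ) S →
      ((S : ℕ) : ℚ) * (q : ℚ) ^ ((2 * δ + h) * (δ + 1))
        + (SubspaceCode.numN q (4 * δ) δ (2 * δ) S : ℚ) *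
            (q : ℚ) ^ (max (δ + h + 1) (2 * δ) * (min (δ + h + 1) (2 * δ) - δ + 1))
        + (1 + SubspaceCode.gaussBinom q (2 * δ) δ * ((q : ℚ) ^ (4 * δ + h) - 1))
        + ∑ i ∈ Finset.Icc 0 2, ∑ j ∈ Finset.Icc 0 (min 1 ((h + 1) / δ - 1)),
            (q : ℚ) ^ (min (((4 - i) * δ - 1) * SubspaceCode.dTwo δ h i j)
                ((h + 1 - j * δ) * SubspaceCode.dOne δ h i j)) *
              (q : ℚ) ^ ((4 - i) * δ + h - j * δ)
        ≤ (SubspaceCode.maxCDCSize F (6 * δ + h) (2 * δ) (2 * δ) : ℚ)) := by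
  -- The statement for the maximum is the case of a code attaining it.
  rw [and_iff_right_of_imp fun H => H _
    (SubspaceCode.exists_isCDC_card_eq_maxCDCSize (by omega : 2 * δ ≤ 4 * δ))]
  subst hq
  rintro _ ⟨C, hC, rfl⟩ -
  obtain ⟨T, hTC, hT, hN⟩ := SubspaceCode.exists_avoiding_code hδ (by simp) C hC.dim_eq
  have hJ1 : 1 ≤ (h + 1) / δ := (Nat.one_le_div_iff (by omega)).2 (by omega)
  have hJ : (min 1 ((h + 1) / δ - 1) + 1) * δ ≤ h + 1 :=
    (Nat.mul_le_mul_right δ (by omega)).trans (Nat.div_mul_le_self (h + 1) δ)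
  have hmain := SubspaceCode.card_families_le_maxCDCSize hδ hh hJ hC hTC hT
  -- `hh` gives `2δ ≤ δ + h + 1`, which settles the maximum and the minimum.
  rw [max_eq_left (by omega), min_eq_right (by omega), show 2 * δ - δ + 1 = δ + 1 by omega]
  refine le_trans (add_le_add (add_le_add_left (add_le_add_right
    (mul_le_mul_of_nonneg_right ?_ (by positivity)) _) _) (le_of_eq ?_)) hmain
  · exact_mod_cast hN
  -- The columns right of the blocks number `(4 - i)δ - 1` and `h + 1 - jδ`; their sum is the stated
  -- exponent.
  · refine Finset.sum_congr rfl fun i hi => Finset.sum_congr rfl fun j hj => ?_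
    have hi2 : i ≤ 2 := (Finset.mem_Icc.1 hi).2
    have hjJ := (Finset.mem_Icc.1 hj).2
    have h1 : i * δ ≤ 2 * δ := Nat.mul_le_mul_right δ hi2
    have h2 : (j + 1) * δ ≤ h + 1 := (Nat.mul_le_mul_right δ (by omega)).trans hJ
    rw [add_mul, one_mul] at h2
    congr 2
    rw [Nat.sub_mul]
    omega
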